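/- \textbf{Definitions.} A (piecewise linear) map $f : K \to \mathbb{R}^2$ of a finite simple graph $K$ assigns to every vertex $v$ a point $f(v)$ of the plane and to every edge $ab$ a polygonal line joining $f(a)$ to $f(b)$, which is traversed in the opposite order when the edge is directed from $b$ to $a$; the image $f(ab)$ of the edge is the union of the segments of this polygonal line. The map $f$ is an \emph{almost embedding} if the images of any two non-adjacent edges are disjoint, the image of a vertex never lies on the image of an edge not containing that vertex, and distinct vertices have distinct images. For points $A, B \neq O$ of the plane let $\angle AOB \in (-\pi, \pi]$ be the oriented angle from $\overrightarrow{OA}$ to $\overrightarrow{OB}$. The \emph{winding number} around $O$ of a closed polygonal line $A_1 \dots A_m$ not passing through $O$ is the integer $$w(A_1 \dots A_m, O) := \frac{1}{2\pi}\left(\angle A_1OA_2 + \angle A_2OA_3 + \dots + \angle A_{m-1}OA_m + \angle A_mOA_1\right).$$ For an oriented cycle $C = v_1 \dots v_n$ of $K$ and a vertex $v$ with $f(v) \notin f(C)$, let $w_f(C, v)$ be the winding number around $f(v)$ of the closed polygonal line obtained by concatenating the polygonal lines of the directed edges $v_1v_2, \dots, v_{n-1}v_n, v_nv_1$. Let $K_5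 - 45$ be the graph obtained from the complete graph $K_5$ on the vertices $1, 2, 3, 4, 5$ by removing the edge $45$. \textbf{Theorem.} For every almost embedding $f : K_5 - 45 \to \mathbb{R}^2$ the integers $w_f(123, 4)$ and $w_f(123, 5)$ satisfy (a) $w_f(123, 4) - w_f(123, 5) \equiv 1 \pmod 2$; (b) $w_f(123, 4) - w_f(123, 5) = \pm 1$. -/

import Mathlib

/-! Throughout, the Euclidean plane `ℝ²` is `ℂ`, with its standard orientation. -/

/-- The oriented angle `∠AOB ∈ (-π, π]` (for `A ≠ O ≠ B`): the `t` such that the vector `OB` is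
codirectional with the vector `OA` rotated counterclockwise by `t`. -/
noncomputable def orientedAngle (A O B : ℂ) : ℝ :=
  Complex.arg ((B - O) / (A - O))

/-- A polygonal line `A₁ … Aₘ` is the list of its successive vertices.
Its image is the union of the segments `A₁A₂, …, Aₘ₋₁Aₘ` (and the point `A₁` if `m = 1`). -/
def polylineImage : List ℂ → Set ℂ
  | [] => ∅
  | [A] => {A}
  | A :: B :: l => segment ℝ A B ∪ polylineImage (B :: l)

/-- `∠A₁OA₂ + ∠A₂OA₃ + … + ∠Aₘ₋₁OAₘ` for a polygonal line `A₁ … Aₘ`. -/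
noncomputable def angleSum (O : ℂ) : List ℂ → ℝ
  | [] => 0
  | [_] => 0
  | A :: B :: l => orientedAngle A O B + angleSum O (B :: l)

/-- The winding number around `O` of the closed polygonal line with successive vertices
`A₁, …, Aₘ`, which is `(∠A₁OA₂ + … + ∠Aₘ₋₁OAₘ + ∠AₘOA₁) / 2π`. -/
noncomputable def polygonWinding (l : List ℂ) (O : ℂ) : ℝ :=
  angleSum O (l ++ l.take 1) / (2 * Real.pi)

/-- A piecewise linear map of a graph `K` to the plane: a point for every vertex and, for every
edge with a chosen direction from `a` to `b`, a polygonal line from the point of `a` to the point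
of `b`; reversing the direction of the edge reverses the polygonal line. -/
structure PLMap {V : Type*} (K : SimpleGraph V) where
  vertex : V → ℂ
  edge : ∀ {a b : V}, K.Adj a b → List ℂ
  edge_head : ∀ {a b : V} (h : K.Adj a b), (edge h).head? = some (vertex a)
  edge_last : ∀ {a b : V} (h : K.Adj a b), (edge h).getLast? = some (vertex b)
  edge_symm : ∀ {a b : V} (h : K.Adj a b), edge h.symm = (edge h).reverse

namespace PLMap

variable {V : Type*} {K : SimpleGraph V}

/-- Almost embeddings: the images of non-adjacent edges are disjoint, the image of a vertex does
not lie on the image of an edge not containing it, and distinct vertices have distinct images. -/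
structure IsAlmostEmbedding (f : PLMap K) : Prop where
  edge_edge : ∀ {a b c d : V} (h : K.Adj a b) (h' : K.Adj c d),
    a ≠ c → a ≠ d → b ≠ c → b ≠ d →
      polylineImage (f.edge h) ∩ polylineImage (f.edge h') = ∅
  vertex_edge : ∀ {a b : V} (v : V) (h : K.Adj a b), v ≠ a → v ≠ b →
    f.vertex v ∉ polylineImage (f.edge h)
  vertex_vertex : ∀ {u v : V}, u ≠ v → f.vertex u ≠ f.vertex v

/-- The concatenation of the polygonal lines of the successive edges of a walk, without the final
point. When the walk is closed, this lists the successive vertices of the closed polygonal line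
that is the restriction of `f` to the walk. -/
def restrict (f : PLMap K) : ∀ {u v : V}, K.Walk u v → List ℂ
  | _, _, .nil => []
  | _, _, .cons h p => (f.edge h).dropLast ++ f.restrict p

/-- `w_f(C, v)`: the winding number of the restriction of `f` to `C` around the image of `v`. -/
noncomputable def winding (f : PLMap K) {u : V} (C : K.Walk u u) (v : V) : ℝ :=
  polygonWinding (f.restrict C) (f.vertex v)

end PLMap

/-- The graph `K₅ - 45`. Its vertices `1, 2, 3, 4, 5` are called `0, 1, 2, 3, 4` here, so the
removed edge joins `3` and `4`. -/
def K5minus45 : SimpleGraph (Fin 5) :=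
  (⊤ : SimpleGraph (Fin 5)).deleteEdges {s(3, 4)}

/-- The oriented cycle `123` of `K₅ - 45`, which is `0 → 1 → 2 → 0` in the present labelling. -/
def cycle123 : K5minus45.Walk 0 0 :=
  have h01 : K5minus45.Adj 0 1 := by simp [K5minus45]
  have h12 : K5minus45.Adj 1 2 := by simp [K5minus45]
  have h20 : K5minus45.Adj 2 0 := by simp [K5minus45]
  .cons h01 (.cons h12 (.cons h20 .nil))

/-! Let `p` and `q` be the images of the vertices 4 and 5. For `i` = 1, 2, 3 the edges `4i` and `i5`
form a path from `p` to `q` marked at the image of `i`. Almost embeddedness makes opposite halves of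
two such paths disjoint, and makes the edge `jk` disjoint from the path through the third vertex
`i`.

Parity. For disjoint polygonal lines, the angles under which each is seen from the ends of the other
balance (`angleSum_sub_angleSum_of_disjoint`). So the angle swept by the edge `jk` around `q` minus
that around `p` is the change, from one end of `jk` to the other, of the angle under which path `i`
is seen. Let `W` be `2π` times the winding number around `q` minus that around `p`. Summing over the
cycle and pairing terms by `angle_mid_add_angle_mid` gives `W = 2t`, where `t` is up to sign a sum
of three numbers congruent to `π` mod `2π`. Hence `W / 2π` is odd.

Bound. Shrink each path to one whose halves meet only in the marked point (`exists_isClean`). For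
two such paths, a Janiszewski-type separation argument shows that the complementary region
containing the marked point of a third path adheres to one of their two marked points. The
difference of the angles under which the two paths are seen is constant on that region, which
determines it up to an error `π` (`abs_angle_sub_angle_sub_le`). Three uses at the vertices of the
cycle and one at a marked point of a shrunk path give `|W| ≤ 3π + π`, so `|t| ≤ 2π`; an odd multiple
of `π` in this range is `±π`. -/

/-! ### Plane topology: lifting of circle-valued maps and separation. -/

/-- Every continuous map from the plane to the circle has a continuous real argument. -/
theorem exists_continuous_circleExp_lift (φ : C(ℂ, Circle)) :
    ∃ ψ : C(ℂ, ℝ), ∀ z, Circle.exp (ψ z) = φ z := by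
  obtain ⟨e, he⟩ := Circle.exp_surjective (φ 0)
  obtain ⟨ψ, ⟨-, h⟩, -⟩ :=
    Circle.isCoveringMap_exp.existsUnique_continuousMap_lifts φ 0 e he
  exact ⟨ψ, fun z => congrFun h z⟩

/-- A continuous function with `exp (i g) = 1` is constant on connected sets. -/
theorem IsPreconnected.eq_of_circleExp_eq_one {s : Set ℂ} (hs : IsPreconnected s) {g : ℂ → ℝ}
    (hg : ContinuousOn g s) (h1 : ∀ z ∈ s, Circle.exp (g z) = 1) {a b : ℂ} (ha : a ∈ s)
    (hb : b ∈ s) : g a = g b := by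
  let T : Set ℝ := Set.range fun n : ℤ => (n : ℝ)
  have hT : DiscreteTopology T :=
    (Int.isClosedEmbedding_coe_real.isEmbedding.toHomeomorph.symm.isEmbedding).discreteTopology
  have hm : Set.MapsTo (fun z => g z / (2 * Real.pi)) s T := by
    intro z hz
    obtain ⟨n, hn⟩ := Circle.exp_eq_one.mp (h1 z hz)
    refine ⟨n, ?_⟩
    have := Real.pi_pos
    simp only
    rw [hn]
    field_simp
  have h := hs.constant_of_mapsTo (T := T) ⟨hT⟩ (hg.div_const _) hm ha hb
  exact (div_left_inj' Real.two_pi_pos.ne').mp h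

/-- The complement of a component of the complement of a connected set is connected. -/
theorem isPreconnected_compl_component {H : Set ℂ} (hc : IsClosed H) (hH : IsConnected H) (z : ℂ) :
    IsPreconnected (connectedComponentIn Hᶜ z)ᶜ := by
  obtain ⟨x, hx⟩ := hH.nonempty
  have hsub : H ⊆ (connectedComponentIn Hᶜ z)ᶜ := fun y hy hy' =>
    connectedComponentIn_subset _ _ hy' hy
  have hopen : ∀ w, IsOpen (connectedComponentIn Hᶜ w) := fun w =>
    hc.isOpen_compl.connectedComponentIn
  refine isPreconnected_of_forall x fun y hy => ?_
  by_cases hyH : y ∈ H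
  · exact ⟨H, hsub, hx, hyH, hH.isPreconnected⟩
  set E := connectedComponentIn Hᶜ y with hE
  have hyE : y ∈ E := mem_connectedComponentIn hyH
  have hdisj : Disjoint (connectedComponentIn Hᶜ z) E := by
    rw [Set.disjoint_left]
    intro w hw hw'
    apply hy
    rw [connectedComponentIn_eq hw, ← connectedComponentIn_eq hw']
    exact hyE
  have hcl : closure E ⊆ (connectedComponentIn Hᶜ z)ᶜ := fun w hw hw' =>
    Set.disjoint_left.mp (hdisj.closure_right (hopen z)) hw' hw
  -- A component whose closure misses `H` would be clopen in the plane.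
  have hmeet : (closure E ∩ H).Nonempty := by
    by_contra hne
    rw [Set.not_nonempty_iff_eq_empty] at hne
    have hcE : closure E ⊆ E :=
      (isPreconnected_connectedComponentIn.closure).subset_connectedComponentIn
        (subset_closure hyE) (fun w hw hw' => by
          have : w ∈ closure E ∩ H := ⟨hw, hw'⟩
          simp [hne] at this)
    have hclopen : IsClopen E := ⟨closure_subset_iff_isClosed.mp hcE, hopen y⟩
    rcases isClopen_iff.mp hclopen with h | h
    · rw [h] at hyE; exact hyE
    · have : x ∈ E := h ▸ Set.mem_univ x
      exact connectedComponentIn_subset _ _ this hx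
  obtain ⟨w, hwE, hwH⟩ := hmeet
  refine ⟨closure E ∪ H, Set.union_subset hcl hsub, Or.inr hx, Or.inl (subset_closure hyE), ?_⟩
  exact IsPreconnected.union w hwE hwH isPreconnected_connectedComponentIn.closure
    hH.isPreconnected

/-- Two sides of a plane domain: the common boundary of a connected open set and its connected
complement is not a disjoint union of two nonempty closed sets. -/
theorem frontier_not_separated {D F G : Set ℂ} (hD : IsOpen D) (hDc : IsPreconnected D)
    (hR : IsPreconnected Dᶜ) (hF : IsClosed F) (hG : IsClosed G) (hFG : Disjoint F G)
    (hfr : frontier D ⊆ F ∪ G) {a b : ℂ} (ha : a ∈ frontier D) (haF : a ∈ F)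
    (hb : b ∈ frontier D) (hbG : b ∈ G) : False := by
  classical
  obtain ⟨u, hu0, hu1, -⟩ := exists_continuous_zero_one_of_isClosed hF hG hFG
  -- The two formulas agree on the frontier, where `u` is 0 or 1, because `exp (iπ) = exp (-iπ)`.
  have hcont : Continuous fun z => if z ∈ D then Circle.exp (Real.pi * u z)
      else Circle.exp (-(Real.pi * u z)) := by
    refine Continuous.if ?_ (by fun_prop) (by fun_prop)
    intro z hz
    rcases hfr hz with h | h
    · have : u z = 0 := hu0 h
      simp [this]
    · have : u z = 1 := hu1 h
      rw [this, mul_one, Circle.exp_neg, eq_inv_iff_mul_eq_one, ← Circle.exp_add, ← two_mul]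
      exact Circle.exp_two_pi
  obtain ⟨ψ, hψ⟩ := exists_continuous_circleExp_lift ⟨_, hcont⟩
  have h1 : ∀ z ∈ closure D, ∀ w ∈ closure D,
      ψ z - Real.pi * u z = ψ w - Real.pi * u w := by
    have key : ∀ z ∈ closure D, Circle.exp (ψ z - Real.pi * u z) = 1 := by
      have hcl : IsClosed {z | Circle.exp (ψ z - Real.pi * u z) = 1} :=
        isClosed_eq (by fun_prop) continuous_const
      refine fun z hz => (closure_minimal (fun z hz => ?_) hcl) hz
      have := hψ z
      simp only [ContinuousMap.coe_mk, if_pos hz] at this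
      simp [Circle.exp_sub, this]
    intro z hz w hw
    exact hDc.closure.eq_of_circleExp_eq_one (g := fun z => ψ z - Real.pi * u z)
      (by fun_prop) key hz hw
  have h2 : ∀ z ∈ Dᶜ, ∀ w ∈ Dᶜ, ψ z + Real.pi * u z = ψ w + Real.pi * u w := by
    have key : ∀ z ∈ Dᶜ, Circle.exp (ψ z + Real.pi * u z) = 1 := by
      intro z hz
      have := hψ z
      simp only [ContinuousMap.coe_mk, if_neg hz] at this
      simp [Circle.exp_add, this, Circle.exp_neg]
    intro z hz w hw
    exact hR.eq_of_circleExp_eq_one (g := fun z => ψ z + Real.pi * u z)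
      (by fun_prop) key hz hw
  rw [hD.frontier_eq] at ha hb
  -- From `a` to `b` the lift `ψ` would change by `π` through `closure D` and by `-π` through the
  -- complement of `D`.
  have e1 := h1 a ha.1 b hb.1
  have e2 := h2 a ha.2 b hb.2
  have ua : u a = 0 := hu0 haF
  have ub : u b = 1 := hu1 hbG
  rw [ua, ub] at e1 e2
  have := Real.pi_pos
  linarith

/-- If `z` can be joined to `α` off `β` and to `β` off `α`, where `α ∪ β` is connected, then the
component of `z` in the complement of `α ∪ β` adheres to a common point of `α` and `β`. -/
theorem exists_mem_inter_closure_component {α β P Q : Set ℂ} {z : ℂ} (hα : IsClosed α)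
    (hβ : IsClosed β) (hαβ : IsConnected (α ∪ β)) (hz : z ∉ α ∪ β)
    (hP : IsPreconnected P) (hzP : z ∈ P) (hPα : (P ∩ α).Nonempty) (hPβ : P ∩ β = ∅)
    (hQ : IsPreconnected Q) (hzQ : z ∈ Q) (hQβ : (Q ∩ β).Nonempty) (hQα : Q ∩ α = ∅) :
    ∃ x ∈ α ∩ β, x ∈ closure (connectedComponentIn (α ∪ β)ᶜ z) := by
  set D := connectedComponentIn (α ∪ β)ᶜ z with hDdef
  have hopen : IsOpen D := (hα.union hβ).isOpen_compl.connectedComponentIn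
  have hzD : z ∈ D := mem_connectedComponentIn hz
  have hfr : frontier D ⊆ α ∪ β := by
    intro w hw
    by_contra hwn
    rw [hopen.frontier_eq] at hw
    have hsub : insert w D ⊆ D := by
      refine IsPreconnected.subset_connectedComponentIn ?_ (Or.inr hzD) ?_
      · exact isPreconnected_connectedComponentIn.subset_closure (Set.subset_insert _ _)
          (Set.insert_subset hw.1 subset_closure)
      · exact Set.insert_subset hwn (connectedComponentIn_subset _ _)
    exact hw.2 (hsub (Set.mem_insert _ _))
  -- A connected set leaving `D` crosses its frontier, which lies in `s ∪ t`; if the set avoids `t`,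
  -- the crossing is in `s`.
  have reach : ∀ {s t T : Set ℂ}, s ∪ t = α ∪ β → IsPreconnected T → z ∈ T → (T ∩ s).Nonempty →
      T ∩ t = ∅ → (frontier D ∩ s).Nonempty := by
    intro s t T hst hT hzT hTs hTt
    obtain ⟨y, hyT, hys⟩ := hTs
    have hyD : y ∉ D := fun h => connectedComponentIn_subset _ _ h (hst ▸ Or.inl hys)
    obtain ⟨w, hwT, hw⟩ : (T ∩ frontier D).Nonempty := by
      by_contra hne
      have hoff : ∀ w ∈ T, w ∈ closure D → w ∈ D := fun w hw hwc => by
        by_contra hwD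
        exact hne ⟨w, hw, by rw [hopen.frontier_eq]; exact ⟨hwc, hwD⟩⟩
      obtain ⟨w, -, hw, hw'⟩ := hT D (closure D)ᶜ hopen isClosed_closure.isOpen_compl
        (fun w hw => or_iff_not_imp_right.mpr fun h => hoff w hw (not_not.mp h))
        ⟨z, hzT, hzD⟩ ⟨y, hyT, fun h => hyD (hoff y hyT h)⟩
      exact hw' (subset_closure hw)
    have : w ∈ s ∪ t := hst ▸ hfr hw
    rcases this with h | h
    · exact ⟨w, hw, h⟩
    · have : w ∈ T ∩ t := ⟨hwT, h⟩
      simp [hTt] at this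
  obtain ⟨a, haD, haα⟩ := reach rfl hP hzP hPα hPβ
  obtain ⟨b, hbD, hbβ⟩ := reach (Set.union_comm β α) hQ hzQ hQβ hQα
  by_contra hne
  push Not at hne
  refine frontier_not_separated (F := closure D ∩ α) (G := closure D ∩ β) hopen
    isPreconnected_connectedComponentIn
    (isPreconnected_compl_component (hα.union hβ) hαβ z) (isClosed_closure.inter hα)
    (isClosed_closure.inter hβ) ?_ ?_ haD ⟨frontier_subset_closure haD, haα⟩ hbD
    ⟨frontier_subset_closure hbD, hbβ⟩
  · rw [Set.disjoint_left]
    exact fun w hw hw' => hne w ⟨hw.2, hw'.2⟩ hw.1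
  · intro w hw
    rcases hfr hw with h | h
    · exact Or.inl ⟨frontier_subset_closure hw, h⟩
    · exact Or.inr ⟨frontier_subset_closure hw, h⟩

/-! ### Polygonal lines and angle sums -/

/-- A ratio `r ≤ 0` would exhibit `z` as the convex combination of `A` and `B` with weights `-r / (1
- r)` and `1 / (1 - r)`. Off the segment, the oriented angle therefore stays away from the
discontinuity of `arg`. -/
theorem sub_div_sub_mem_slitPlane {A B z : ℂ} (h : z ∉ segment ℝ A B) :
    (B - z) / (A - z) ∈ Complex.slitPlane := by
  have hA : A - z ≠ 0 := fun h0 => h (by rw [← sub_eq_zero.mp h0]; exact left_mem_segment ℝ A B)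
  by_contra hs
  rw [Complex.mem_slitPlane_iff_not_le_zero, not_not] at hs
  obtain ⟨hre, him⟩ := Complex.le_def.mp hs
  simp only [Complex.zero_re, Complex.zero_im] at hre him
  set r := ((B - z) / (A - z)).re with hr
  have e : (B - z) / (A - z) = (r : ℂ) := Complex.ext rfl (by simpa using him)
  rw [div_eq_iff hA] at e
  apply h
  have h1 : 0 < 1 - r := by linarith
  refine ⟨-r / (1 - r), 1 / (1 - r), div_nonneg (by linarith) h1.le, by positivity, ?_, ?_⟩
  · rw [← add_div, neg_add_eq_sub, div_self h1.ne']
  · have h2 : (1 - (r : ℂ)) ≠ 0 := by exact_mod_cast h1.ne'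
    simp only [Complex.real_smul]
    push_cast
    field_simp
    linear_combination e

theorem head_mem_polylineImage (A : ℂ) (l : List ℂ) : A ∈ polylineImage (A :: l) := by
  cases l with
  | nil => exact rfl
  | cons B l => exact Or.inl (left_mem_segment ℝ A B)

theorem polylineImage_append_cons (l : List ℂ) (x : ℂ) (r : List ℂ) :
    polylineImage (l ++ x :: r) = polylineImage (l ++ [x]) ∪ polylineImage (x :: r) := by
  induction l with
  | nil =>
    exact (Set.union_eq_self_of_subset_left
      (Set.singleton_subset_iff.mpr (head_mem_polylineImage x r))).symm
  | cons A l ih =>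
    cases l with
    | nil =>
      change segment ℝ A x ∪ polylineImage (x :: r) =
        (segment ℝ A x ∪ {x}) ∪ polylineImage (x :: r)
      rw [Set.union_eq_self_of_subset_right
        (Set.singleton_subset_iff.mpr (right_mem_segment ℝ A x))]
    | cons B l =>
      change segment ℝ A B ∪ polylineImage ((B :: l) ++ x :: r) =
        (segment ℝ A B ∪ polylineImage ((B :: l) ++ [x])) ∪ polylineImage (x :: r)
      rw [ih, Set.union_assoc]

theorem angleSum_append_cons (z : ℂ) (l : List ℂ) (x : ℂ) (r : List ℂ) :
    angleSum z (l ++ x :: r) = angleSum z (l ++ [x]) + angleSum z (x :: r) := by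
  induction l with
  | nil => simp [angleSum]
  | cons A l ih =>
    cases l with
    | nil => simp [angleSum]
    | cons B l =>
      change orientedAngle A z B + angleSum z ((B :: l) ++ x :: r) =
        (orientedAngle A z B + angleSum z ((B :: l) ++ [x])) + angleSum z (x :: r)
      rw [ih, add_assoc]

theorem isCompact_polylineImage (l : List ℂ) : IsCompact (polylineImage l) := by
  induction l with
  | nil => exact isCompact_empty
  | cons A l ih =>
    cases l with
    | nil => exact isCompact_singleton
    | cons B l =>
      refine IsCompact.union ?_ ih
      rw [← convexHull_pair]
      exact (Set.toFinite _).isCompact_convexHull ℝ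

theorem isConnected_polylineImage (A : ℂ) (l : List ℂ) : IsConnected (polylineImage (A :: l)) := by
  induction l generalizing A with
  | nil => exact isConnected_singleton
  | cons B l ih =>
    exact IsConnected.union ⟨B, right_mem_segment ℝ A B, head_mem_polylineImage B l⟩
      ((convex_segment A B).isConnected ⟨A, left_mem_segment ℝ A B⟩) (ih B)

theorem last_mem_polylineImage {l : List ℂ} {x : ℂ} (h : l.getLast? = some x) :
    x ∈ polylineImage l := by
  obtain ⟨l, rfl⟩ := List.getLast?_eq_some_iff.mp h
  rw [polylineImage_append_cons l x []]
  exact Or.inr rfl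

theorem exists_eq_cons_of_head? {l : List ℂ} {x : ℂ} (h : l.head? = some x) :
    ∃ r, l = x :: r := by
  cases l with
  | nil => simp at h
  | cons y r => exact ⟨r, by simpa using h⟩

theorem first_mem_polylineImage {l : List ℂ} {x : ℂ} (h : l.head? = some x) :
    x ∈ polylineImage l := by
  obtain ⟨r, rfl⟩ := exists_eq_cons_of_head? h
  exact head_mem_polylineImage x r

theorem continuousAt_orientedAngle {A B z : ℂ} (h : z ∉ segment ℝ A B) :
    ContinuousAt (fun w => orientedAngle A w B) z := by
  have hA : A - z ≠ 0 := fun h0 => h (by rw [← sub_eq_zero.mp h0]; exact left_mem_segment ℝ A B)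
  exact ContinuousAt.comp (f := fun w => (B - w) / (A - w)) (x := z)
    (Complex.continuousAt_arg (sub_div_sub_mem_slitPlane h))
    (ContinuousAt.div (by fun_prop) (by fun_prop) hA)

theorem continuousAt_angleSum {l : List ℂ} {z : ℂ} (h : z ∉ polylineImage l) :
    ContinuousAt (fun w => angleSum w l) z := by
  induction l with
  | nil => exact continuousAt_const
  | cons A l ih =>
    cases l with
    | nil => exact continuousAt_const
    | cons B l =>
      exact (continuousAt_orientedAngle fun h' => h (Or.inl h')).add (ih fun h' => h (Or.inr h'))

/-- Modulo `2π` each oriented angle is a difference of two arguments, and the sum telescopes. -/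
theorem coe_angleSum {l : List ℂ} {A B z : ℂ} (hA : l.head? = some A) (hB : l.getLast? = some B)
    (h : z ∉ polylineImage l) :
    (angleSum z l : Real.Angle) = (B - z).arg - (A - z).arg := by
  induction l generalizing A with
  | nil => simp at hA
  | cons A' l ih =>
    obtain rfl : A' = A := by simpa using hA
    cases l with
    | nil =>
      obtain rfl : A' = B := by simpa using hB
      simp [angleSum]
    | cons C l =>
      have hC : z ∉ polylineImage (C :: l) := fun h' => h (Or.inr h')
      have hA0 : A' - z ≠ 0 := fun h0 => h (by
        rw [← sub_eq_zero.mp h0]; exact head_mem_polylineImage _ _)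
      have hC0 : C - z ≠ 0 := fun h0 => hC (by
        rw [← sub_eq_zero.mp h0]; exact head_mem_polylineImage _ _)
      have := ih rfl (by simpa using hB) hC
      rw [angleSum, Real.Angle.coe_add, this, orientedAngle, Complex.arg_div_coe_angle hC0 hA0]
      abel

/-- Both arguments lie in `(-π/2, π/2)`, so their difference is already a principal value. -/
theorem arg_div_eq_sub_of_re_pos {x y : ℂ} (hx : 0 < x.re) (hy : 0 < y.re) :
    (x / y).arg = x.arg - y.arg := by
  have hx0 : x ≠ 0 := fun h => by simp [h] at hx
  have hy0 : y ≠ 0 := fun h => by simp [h] at hy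
  have h1 := abs_lt.mp (Complex.abs_arg_lt_pi_div_two_iff.mpr (Or.inl hx))
  have h2 := abs_lt.mp (Complex.abs_arg_lt_pi_div_two_iff.mpr (Or.inl hy))
  have h : ((x / y).arg : Real.Angle) = ((x.arg - y.arg : ℝ) : Real.Angle) := by
    rw [Complex.arg_div_coe_angle hx0 hy0, Real.Angle.coe_sub]
  rw [← Complex.arg_coe_angle_toReal_eq_arg, h, Real.Angle.toReal_coe_eq_self_iff]
  constructor <;> linarith [h1.1, h1.2, h2.1, h2.2]

/-- For two disjoint segments `AB` and `CD`, the four angles at their end points balance. -/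
theorem orientedAngle_sub_orientedAngle_of_disjoint {A B C D : ℂ}
    (h : Disjoint (segment ℝ A B) (segment ℝ C D)) :
    orientedAngle A D B - orientedAngle A C B = orientedAngle C B D - orientedAngle C A D := by
  have hcompact : ∀ X Y : ℂ, IsCompact (segment ℝ X Y) := fun X Y => by
    rw [← convexHull_pair]
    exact (Set.toFinite _).isCompact_convexHull ℝ
  obtain ⟨f, s, t, hs, hst, ht⟩ := geometric_hahn_banach_compact_closed (convex_segment A B)
    (hcompact A B) (convex_segment C D) (hcompact C D).isClosed h
  -- Multiplication by `c` rotates the separating direction onto the real axis: `Re (c w) = -f w`.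
  -- All four differences of end points then lie in the right half-plane, where arguments subtract
  -- without a `2π` correction.
  set c : ℂ := -((f 1 : ℂ) - f Complex.I * Complex.I) with hc
  have hre : ∀ w : ℂ, (c * w).re = -f w := by
    intro w
    have : f w = w.re * f 1 + w.im * f Complex.I := by
      conv_lhs => rw [← Complex.re_add_im w, mul_comm]
      have e1 : (w.re : ℂ) = w.re • (1 : ℂ) := by simp
      have e2 : Complex.I * (w.im : ℂ) = w.im • Complex.I := by simp [mul_comm]
      rw [e1, e2, map_add, map_smul, map_smul, smul_eq_mul, smul_eq_mul]
    rw [this]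
    simp [hc]
    ring
  have hpos : ∀ X ∈ segment ℝ A B, ∀ Y ∈ segment ℝ C D, 0 < (c * (X - Y)).re := by
    intro X hX Y hY
    rw [hre, map_sub]
    linarith [hs X hX, ht Y hY]
  have hA := left_mem_segment ℝ A B
  have hB := right_mem_segment ℝ A B
  have hC := left_mem_segment ℝ C D
  have hD := right_mem_segment ℝ C D
  have hc0 : c ≠ 0 := fun h0 => by simpa [h0] using hpos A hA C hC
  have e : ∀ X Y O : ℂ, orientedAngle X O Y = ((c * (Y - O)) / (c * (X - O))).arg := by
    intro X Y O
    rw [orientedAngle, mul_div_mul_left _ _ hc0]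
  have e' : ∀ X Y O : ℂ, orientedAngle X O Y = ((c * (O - Y)) / (c * (O - X))).arg := by
    intro X Y O
    rw [orientedAngle, mul_div_mul_left _ _ hc0, ← neg_sub O Y, ← neg_sub O X, neg_div_neg_eq]
  rw [e, e, e', e', arg_div_eq_sub_of_re_pos (hpos B hB D hD) (hpos A hA D hD),
    arg_div_eq_sub_of_re_pos (hpos B hB C hC) (hpos A hA C hC),
    arg_div_eq_sub_of_re_pos (hpos B hB D hD) (hpos B hB C hC),
    arg_div_eq_sub_of_re_pos (hpos A hA D hD) (hpos A hA C hC)]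
  ring

theorem orientedAngle_sub_eq_angleSum_sub {N : List ℂ} {A B C D : ℂ} (hC : N.head? = some C)
    (hD : N.getLast? = some D) (h : Disjoint (segment ℝ A B) (polylineImage N)) :
    orientedAngle A D B - orientedAngle A C B = angleSum B N - angleSum A N := by
  induction N generalizing C with
  | nil => simp at hC
  | cons C₀ N ih =>
    obtain rfl : C₀ = C := by simpa using hC
    cases N with
    | nil =>
      obtain rfl : C₀ = D := by simpa using hD
      simp [angleSum]
    | cons C' N =>
      have h1 := ih rfl (by simpa using hD) (h.mono_right Set.subset_union_right)
      have h2 := orientedAngle_sub_orientedAngle_of_disjoint (h.mono_right Set.subset_union_left)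
      simp only [angleSum]
      linarith

/-- For two disjoint polygonal lines, the four angle sums at their end points balance. -/
theorem angleSum_sub_angleSum_of_disjoint {M N : List ℂ} {A B C D : ℂ} (hA : M.head? = some A)
    (hB : M.getLast? = some B) (hC : N.head? = some C) (hD : N.getLast? = some D)
    (h : Disjoint (polylineImage M) (polylineImage N)) :
    angleSum D M - angleSum C M = angleSum B N - angleSum A N := by
  induction M generalizing A with
  | nil => simp at hA
  | cons A₀ M ih =>
    obtain rfl : A₀ = A := by simpa using hA
    cases M with
    | nil =>
      obtain rfl : A₀ = B := by simpa using hB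
      simp [angleSum]
    | cons A' M =>
      have h1 := ih rfl (by simpa using hB) (h.mono_left Set.subset_union_right)
      have h2 := orientedAngle_sub_eq_angleSum_sub hC hD (h.mono_left Set.subset_union_left)
      simp only [angleSum]
      linarith

/-! ### Subdividing polygonal lines -/

/-- The part of a polygonal line after its last visit to a point of its image. -/
theorem exists_last_visit {L : List ℂ} {x q : ℂ} (hx : x ∈ polylineImage L)
    (hq : L.getLast? = some q) (hxq : x ≠ q) :
    ∃ y r, (x :: y :: r).getLast? = some q ∧ x ∉ polylineImage (y :: r) ∧
      polylineImage (x :: y :: r) ⊆ polylineImage L := by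
  induction L with
  | nil => exact hx.elim
  | cons A l ih =>
    cases l with
    | nil =>
      obtain rfl : A = q := by simpa using hq
      exact (hxq hx).elim
    | cons B l =>
      by_cases hB : x ∈ polylineImage (B :: l)
      · obtain ⟨y, r, h1, h2, h3⟩ := ih hB (by simpa using hq)
        exact ⟨y, r, h1, h2, h3.trans Set.subset_union_right⟩
      · have hxs : x ∈ segment ℝ A B := hx.resolve_right hB
        refine ⟨B, l, by simpa using hq, hB, Set.union_subset_union_left _ ?_⟩
        exact (convex_segment A B).segment_subset hxs (right_mem_segment ℝ A B)

/-- The part of a polygonal line before its first visit to a closed set. -/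
theorem exists_first_visit {L : List ℂ} {p : ℂ} {s : Set ℂ} (hs : IsClosed s)
    (hp : L.head? = some p) (hps : p ∉ s) (hL : (polylineImage L ∩ s).Nonempty) :
    ∃ l u x, (l ++ [u]).head? = some p ∧ Disjoint (polylineImage (l ++ [u])) s ∧ x ∈ s ∧
      segment ℝ u x ∩ s ⊆ {x} ∧ polylineImage (l ++ [u, x]) ⊆ polylineImage L := by
  induction L generalizing p with
  | nil => simp at hp
  | cons A L ih =>
    obtain rfl : A = p := by simpa using hp
    cases L with
    | nil =>
      obtain ⟨w, rfl, hw⟩ := hL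
      exact (hps hw).elim
    | cons B L =>
      by_cases hseg : (segment ℝ A B ∩ s).Nonempty
      · set g : ℝ → ℂ := fun t => A + t • (B - A) with hg
        have hgc : Continuous g := by fun_prop
        have hK : IsCompact (Set.Icc (0 : ℝ) 1 ∩ g ⁻¹' s) :=
          isCompact_Icc.inter_right (hs.preimage hgc)
        have hKn : (Set.Icc (0 : ℝ) 1 ∩ g ⁻¹' s).Nonempty := by
          obtain ⟨w, hw, hws⟩ := hseg
          rw [segment_eq_image'] at hw
          obtain ⟨t, ht, rfl⟩ := hw
          exact ⟨t, ht, hws⟩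
        obtain ⟨t, ⟨ht, hts⟩, hmin⟩ := hK.exists_isLeast hKn
        have hts' : g t ∈ s := hts
        have hgt : g t ∈ segment ℝ A B := by
          rw [segment_eq_image']
          exact ⟨t, ht, rfl⟩
        have hsub : segment ℝ A (g t) ⊆ segment ℝ A B :=
          (convex_segment A B).segment_subset (left_mem_segment ℝ A B) hgt
        refine ⟨[], A, g t, rfl, ?_, hts', ?_, ?_⟩
        · exact Set.disjoint_singleton_left.mpr hps
        · rintro w ⟨hw, hws⟩
          rw [segment_eq_image'] at hw
          obtain ⟨τ, hτ, rfl⟩ := hw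
          -- Parameter `τ` on the shortened segment is parameter `τ * t ≤ t` on `AB`, so minimality
          -- of `t` forces equality.
          have e : A + τ • (g t - A) = g (τ * t) := by
            simp only [hg, add_sub_cancel_left, smul_smul]
          simp only [e] at hws ⊢
          have hle : t ≤ τ * t := hmin ⟨⟨mul_nonneg hτ.1 ht.1,
            mul_le_one₀ hτ.2 ht.1 ht.2⟩, hws⟩
          have : τ * t = t := le_antisymm (by nlinarith [hτ.2, ht.1]) hle
          rw [this]
          rfl
        · rintro w (hw | hw)
          · exact Or.inl (hsub hw)
          · rw [show w = g t from hw]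
            exact Or.inl hgt
      · have hBs : B ∉ s := fun h => hseg ⟨B, right_mem_segment ℝ A B, h⟩
        obtain ⟨w, hw | hw, hws⟩ := hL
        · exact (hseg ⟨w, hw, hws⟩).elim
        obtain ⟨l, u, x, h1, h2, h3, h4, h5⟩ := ih rfl hBs ⟨w, hw, hws⟩
        obtain ⟨r, hr⟩ := exists_eq_cons_of_head? h1
        have hr' : l ++ [u, x] = B :: (r ++ [x]) := by
          rw [← List.cons_append, ← hr]; simp
        refine ⟨A :: l, u, x, rfl, ?_, h3, h4, ?_⟩
        · rw [List.cons_append, hr]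
          refine Set.disjoint_union_left.mpr ⟨?_, hr ▸ h2⟩
          exact Set.disjoint_iff_inter_eq_empty.mpr (Set.not_nonempty_iff_eq_empty.mp hseg)
        · rw [List.cons_append, hr']
          exact Set.union_subset_union_right _ (hr' ▸ h5)

open scoped Topology
open Filter

/-! ### Paths with a marked point -/

/-- Two polygonal lines, from `p` to `mid` and from `mid` to `q`. -/
structure TwoPath (p q : ℂ) where
  fst : List ℂ
  snd : List ℂ
  mid : ℂ
  fst_head : fst.head? = some p
  fst_last : fst.getLast? = some mid
  snd_head : snd.head? = some mid
  snd_last : snd.getLast? = some q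

namespace TwoPath

variable {p q : ℂ}

/-- The union of the two polygonal lines. -/
def image (c : TwoPath p q) : Set ℂ := polylineImage c.fst ∪ polylineImage c.snd

/-- The angle under which the whole path is seen from `z`. -/
noncomputable def angle (c : TwoPath p q) (z : ℂ) : ℝ := angleSum z c.fst + angleSum z c.snd

/-- The angle under which the first half is seen from the end of the second one, plus the angle
under which the second half is seen from the beginning of the first one. -/
noncomputable def turn (c : TwoPath p q) : ℝ := angleSum q c.fst + angleSum p c.snd

/-- Each half of one path is disjoint from the opposite half of the other one. -/
def CrossDisjoint (c d : TwoPath p q) : Prop :=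
  Disjoint (polylineImage c.fst) (polylineImage d.snd) ∧
    Disjoint (polylineImage c.snd) (polylineImage d.fst)

theorem CrossDisjoint.symm {c d : TwoPath p q} (h : c.CrossDisjoint d) : d.CrossDisjoint c :=
  ⟨h.2.symm, h.1.symm⟩

/-- The two halves meet only in the marked point, near which the path is seen under an angle that
differs from `turn` by less than `3π`. -/
structure IsClean (c : TwoPath p q) : Prop where
  inter_subset : polylineImage c.fst ∩ polylineImage c.snd ⊆ {c.mid}
  eventually_lt : ∃ ε > 0, ∀ᶠ z in 𝓝 c.mid, |c.angle z - c.turn| < 3 * Real.pi - ε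

section Membership

variable (c : TwoPath p q)

theorem mid_mem_fst : c.mid ∈ polylineImage c.fst := last_mem_polylineImage c.fst_last

theorem mid_mem_snd : c.mid ∈ polylineImage c.snd := first_mem_polylineImage c.snd_head

theorem left_mem_fst : p ∈ polylineImage c.fst := first_mem_polylineImage c.fst_head

theorem right_mem_snd : q ∈ polylineImage c.snd := last_mem_polylineImage c.snd_last

theorem isConnected_fst : IsConnected (polylineImage c.fst) := by
  obtain ⟨r, hr⟩ := exists_eq_cons_of_head? c.fst_head
  rw [hr]
  exact isConnected_polylineImage p r

theorem isConnected_snd : IsConnected (polylineImage c.snd) := by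
  obtain ⟨r, hr⟩ := exists_eq_cons_of_head? c.snd_head
  rw [hr]
  exact isConnected_polylineImage c.mid r

theorem isConnected_image : IsConnected c.image :=
  IsConnected.union ⟨c.mid, c.mid_mem_fst, c.mid_mem_snd⟩ c.isConnected_fst c.isConnected_snd

end Membership

variable {c d e : TwoPath p q}

theorem CrossDisjoint.left_notMem (h : c.CrossDisjoint d) : p ∉ polylineImage c.snd :=
  fun hp => Set.disjoint_left.mp h.2 hp d.left_mem_fst

theorem CrossDisjoint.right_notMem (h : c.CrossDisjoint d) : q ∉ polylineImage c.fst :=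
  fun hq => Set.disjoint_left.mp h.1 hq d.right_mem_snd

theorem CrossDisjoint.mid_notMem (h : c.CrossDisjoint d) : d.mid ∉ c.image := by
  rintro (hm | hm)
  · exact Set.disjoint_left.mp h.1 hm d.mid_mem_snd
  · exact Set.disjoint_left.mp h.2 hm d.mid_mem_fst

theorem continuousAt_angle {z : ℂ} (hz : z ∉ c.image) : ContinuousAt c.angle z :=
  (continuousAt_angleSum fun h => hz (Or.inl h)).add (continuousAt_angleSum fun h => hz (Or.inr h))

theorem coe_angle {z : ℂ} (hz : z ∉ c.image) :
    (c.angle z : Real.Angle) = (q - z).arg - (p - z).arg := by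
  rw [angle, Real.Angle.coe_add, coe_angleSum c.fst_head c.fst_last fun h => hz (Or.inl h),
    coe_angleSum c.snd_head c.snd_last fun h => hz (Or.inr h)]
  abel

/-- This is the angle sum of the triangle `p`, `d.mid`, `q` modulo `2π`: each of its three sides
occurs in both directions, and each reversal contributes `π`. -/
theorem coe_angle_mid_sub_turn (h : c.CrossDisjoint d) :
    ((c.angle d.mid - d.turn : ℝ) : Real.Angle) = Real.pi := by
  have hp := h.symm.left_notMem
  have hq := h.symm.right_notMem
  have hmp : d.mid - p ≠ 0 := sub_ne_zero.mpr (ne_of_mem_of_not_mem d.mid_mem_snd hp)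
  have hmq : d.mid - q ≠ 0 := sub_ne_zero.mpr (ne_of_mem_of_not_mem d.mid_mem_fst hq)
  have hpq : p - q ≠ 0 := sub_ne_zero.mpr (ne_of_mem_of_not_mem d.left_mem_fst hq)
  rw [Real.Angle.coe_sub, coe_angle h.mid_notMem, turn, Real.Angle.coe_add,
    coe_angleSum d.fst_head d.fst_last hq, coe_angleSum d.snd_head d.snd_last hp,
    ← neg_sub d.mid q, ← neg_sub d.mid p, ← neg_sub p q, Complex.arg_neg_coe_angle hmp,
    Complex.arg_neg_coe_angle hmq, Complex.arg_neg_coe_angle hpq]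
  refine Eq.trans ?_ Real.Angle.neg_coe_pi
  abel

/-- The balance of angles is applied to the two pairs of opposite halves. The relation allows `c`
and `d` to exchange roles. -/
theorem angle_mid_add_angle_mid (h : c.CrossDisjoint d) :
    c.angle d.mid + d.angle c.mid = c.turn + d.turn := by
  have h1 := angleSum_sub_angleSum_of_disjoint c.fst_head c.fst_last d.snd_head d.snd_last h.1
  have h2 := angleSum_sub_angleSum_of_disjoint c.snd_head c.snd_last d.fst_head d.fst_last h.2
  simp only [angle, turn]
  linarith

/-- A polygonal line off a path `c` turns around the ends of `c` according to the angles under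
which `c` is seen from its own ends. -/
theorem angleSum_sub_eq_angle_sub {E : List ℂ} {A B : ℂ} (hA : E.head? = some A)
    (hB : E.getLast? = some B) (h1 : Disjoint (polylineImage E) (polylineImage c.fst))
    (h2 : Disjoint (polylineImage E) (polylineImage c.snd)) :
    angleSum q E - angleSum p E = c.angle B - c.angle A := by
  have h1 := angleSum_sub_angleSum_of_disjoint hA hB c.fst_head c.fst_last h1
  have h2 := angleSum_sub_angleSum_of_disjoint hA hB c.snd_head c.snd_last h2
  simp only [angle]
  linarith

theorem _root_.exists_int_of_coe_eq_pi {t : ℝ} (h : (t : Real.Angle) = Real.pi) :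
    ∃ n : ℤ, t = Real.pi + 2 * Real.pi * n := by
  obtain ⟨n, hn⟩ := Real.Angle.angle_eq_iff_two_pi_dvd_sub.mp h
  exact ⟨n, by linarith⟩

theorem _root_.eq_pi_or_eq_neg_pi_of_coe_eq_pi {t : ℝ} (h : (t : Real.Angle) = Real.pi)
    (ht : |t| < 3 * Real.pi) : t = Real.pi ∨ t = -Real.pi := by
  obtain ⟨n, rfl⟩ := exists_int_of_coe_eq_pi h
  have hπ := Real.pi_pos
  obtain ⟨h1, h2⟩ := abs_lt.mp ht
  have h3 : (n : ℝ) < 1 := by nlinarith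
  have h4 : (-2 : ℝ) < n := by nlinarith
  have h5 : n < 1 := by exact_mod_cast h3
  have h6 : -2 < n := by exact_mod_cast h4
  obtain rfl | rfl : n = 0 ∨ n = -1 := by omega
  · left; simp
  · right; push_cast; ring

/-- Off the paths both angles are congruent to `arg (q - z) - arg (p - z)`, so their difference is
continuous with values in `2πℤ`. -/
theorem angle_sub_angle_eq_of_mem {H : Set ℂ} {a b : ℂ} (hH : IsPreconnected H)
    (hc : Disjoint H c.image) (hd : Disjoint H d.image) (ha : a ∈ H) (hb : b ∈ H) :
    c.angle a - d.angle a = c.angle b - d.angle b := by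
  refine hH.eq_of_circleExp_eq_one (g := fun z => c.angle z - d.angle z) ?_ ?_ ha hb
  · intro z hz
    exact ((continuousAt_angle (Set.disjoint_left.mp hc hz)).sub
      (continuousAt_angle (Set.disjoint_left.mp hd hz))).continuousWithinAt
  · intro z hz
    rw [← Real.Angle.toCircle_coe, Real.Angle.coe_sub, coe_angle (Set.disjoint_left.mp hc hz),
      coe_angle (Set.disjoint_left.mp hd hz), sub_self, Real.Angle.toCircle_zero]

/-- The constant difference on `H` can be read off at points of `H` near `d.mid`. There `c.angle` is
continuous and cleanness controls `d.angle`; the margin `ε` absorbs the variation of `c.angle`. -/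
theorem abs_angle_sub_angle_sub_lt_of_mem_closure {H : Set ℂ} {z : ℂ} (hH : IsPreconnected H)
    (hc : Disjoint H c.image) (hd : Disjoint H d.image) (hz : z ∈ H) (hclean : d.IsClean)
    (hm : d.mid ∈ closure H) (hcd : c.CrossDisjoint d) :
    |c.angle z - d.angle z - (c.angle d.mid - d.turn)| < 3 * Real.pi := by
  obtain ⟨ε, hε, hev⟩ := hclean.eventually_lt
  have hcont := continuousAt_angle hcd.mid_notMem
  obtain ⟨w, hwH, hw1, hw2⟩ := ((mem_closure_iff_frequently.mp hm).and_eventually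
    (hev.and (Metric.tendsto_nhds.mp hcont ε hε))).exists
  rw [angle_sub_angle_eq_of_mem hH hc hd hz hwH]
  rw [Real.dist_eq] at hw2
  rw [abs_lt] at hw1 hw2 ⊢
  constructor <;> linarith [hw1.1, hw1.2, hw2.1, hw2.2]

/-- For three pairwise cross-disjoint paths, the first two of them clean, the angles under which
these two are seen from the marked point of the third one differ in a prescribed way up to `π`. -/
theorem abs_angle_sub_angle_sub_le (hcd : c.CrossDisjoint d) (hce : c.CrossDisjoint e)
    (hde : d.CrossDisjoint e) (hc : c.IsClean) (hd : d.IsClean) :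
    |c.angle e.mid - d.angle e.mid - (c.angle d.mid - d.turn)| ≤ Real.pi := by
  set α := polylineImage c.fst ∪ polylineImage d.fst with hα
  set β := polylineImage c.snd ∪ polylineImage d.snd with hβ
  have hunion : α ∪ β = c.image ∪ d.image := Set.union_union_union_comm _ _ _ _
  have hαc : IsClosed α :=
    ((isCompact_polylineImage c.fst).union (isCompact_polylineImage d.fst)).isClosed
  have hβc : IsClosed β :=
    ((isCompact_polylineImage c.snd).union (isCompact_polylineImage d.snd)).isClosed
  -- The halves of `e` join `e.mid` to `p` off all second halves and to `q` off all first halves.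
  obtain ⟨x, ⟨hxα, hxβ⟩, hx⟩ := exists_mem_inter_closure_component (z := e.mid)
    (P := polylineImage e.fst) (Q := polylineImage e.snd) hαc hβc
    (by
      rw [hunion]
      exact IsConnected.union ⟨p, Or.inl c.left_mem_fst, Or.inl d.left_mem_fst⟩
        c.isConnected_image d.isConnected_image)
    (by
      rw [hunion]
      exact fun h => h.elim hce.mid_notMem hde.mid_notMem)
    e.isConnected_fst.isPreconnected e.mid_mem_fst ⟨p, e.left_mem_fst, Or.inl c.left_mem_fst⟩
    (Set.disjoint_iff_inter_eq_empty.mp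
      (Set.disjoint_union_right.mpr ⟨hce.2.symm, hde.2.symm⟩))
    e.isConnected_snd.isPreconnected e.mid_mem_snd ⟨q, e.right_mem_snd, Or.inl c.right_mem_snd⟩
    (Set.disjoint_iff_inter_eq_empty.mp
      (Set.disjoint_union_right.mpr ⟨hce.1.symm, hde.1.symm⟩))
  rw [hunion] at hx
  have hsub := connectedComponentIn_subset (c.image ∪ d.image)ᶜ e.mid
  have hdisjc : Disjoint (connectedComponentIn (c.image ∪ d.image)ᶜ e.mid) c.image :=
    Set.disjoint_left.mpr fun w hw hw' => hsub hw (Or.inl hw')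
  have hdisjd : Disjoint (connectedComponentIn (c.image ∪ d.image)ᶜ e.mid) d.image :=
    Set.disjoint_left.mpr fun w hw hw' => hsub hw (Or.inr hw')
  have hmem : e.mid ∈ connectedComponentIn (c.image ∪ d.image)ᶜ e.mid :=
    mem_connectedComponentIn fun h => h.elim hce.mid_notMem hde.mid_notMem
  have hlt : |c.angle e.mid - d.angle e.mid - (c.angle d.mid - d.turn)| < 3 * Real.pi := by
    have hbal := angle_mid_add_angle_mid hcd
    have hxcd : x = c.mid ∨ x = d.mid := by
      rcases hxα with h1 | h1 <;> rcases hxβ with h2 | h2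
      · exact Or.inl (hc.inter_subset ⟨h1, h2⟩)
      · exact (Set.disjoint_left.mp hcd.1 h1 h2).elim
      · exact (Set.disjoint_left.mp hcd.2 h2 h1).elim
      · exact Or.inr (hd.inter_subset ⟨h1, h2⟩)
    rcases hxcd with rfl | rfl
    · have := abs_angle_sub_angle_sub_lt_of_mem_closure isPreconnected_connectedComponentIn
        hdisjd hdisjc hmem hc hx hcd.symm
      rw [← abs_neg]
      convert this using 2
      linarith
    · exact abs_angle_sub_angle_sub_lt_of_mem_closure isPreconnected_connectedComponentIn
        hdisjc hdisjd hmem hd hx hcd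
  -- The quantity is an odd multiple of `π`, so the strict bound `3π` improves to `π`.
  have hcoe : ((c.angle e.mid - d.angle e.mid - (c.angle d.mid - d.turn) : ℝ) : Real.Angle) =
      Real.pi := by
    rw [Real.Angle.coe_sub, coe_angle_mid_sub_turn hcd, Real.Angle.coe_sub,
      coe_angle hce.mid_notMem, coe_angle hde.mid_notMem, sub_self, zero_sub,
      Real.Angle.neg_coe_pi]
  rcases eq_pi_or_eq_neg_pi_of_coe_eq_pi hcoe hlt with h | h <;> rw [h]
  · rw [abs_of_pos Real.pi_pos]
  · rw [abs_neg, abs_of_pos Real.pi_pos]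

/-! ### Existence of clean paths -/

/-- These are two angles of the triangle `u`, `x`, `y`, with equal orientation, so they add up to
less than `π` in absolute value. Algebraically, `ρ`, `1 - ρ⁻¹` and their product `ρ - 1` have
imaginary parts of the same sign, so the arguments add exactly. In the degenerate case the
hypotheses force both angles to vanish. -/
theorem _root_.abs_orientedAngle_add_orientedAngle_lt {u x y : ℂ} (hu : u ∉ segment ℝ x y)
    (hy : y ∉ segment ℝ u x) :
    |orientedAngle x u y + orientedAngle u y x| < Real.pi := by
  have hπ := Real.pi_pos
  have hxu : x - u ≠ 0 := fun h0 => hu (by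
    rw [← sub_eq_zero.mp h0]; exact left_mem_segment ℝ x y)
  have hyu : y - u ≠ 0 := fun h0 => hu (by
    rw [← sub_eq_zero.mp h0]; exact right_mem_segment ℝ x y)
  have hxy : x - y ≠ 0 := fun h0 => hy (by
    rw [← sub_eq_zero.mp h0]; exact right_mem_segment ℝ u x)
  have huy : u - y ≠ 0 := fun h0 => hyu (by linear_combination -h0)
  have s1 := sub_div_sub_mem_slitPlane hu
  have s2 := sub_div_sub_mem_slitPlane hy
  unfold orientedAngle
  set ρ := (y - u) / (x - u) with hρ
  have hρ0 : ρ ≠ 0 := div_ne_zero hyu hxu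
  have e2 : (x - y) / (u - y) = 1 - ρ⁻¹ := by
    rw [hρ]
    field_simp
    ring
  rw [e2] at s2 ⊢
  have h20 : 1 - ρ⁻¹ ≠ 0 := e2 ▸ div_ne_zero hxy huy
  have him : (1 - ρ⁻¹).im = ρ.im / Complex.normSq ρ := by
    simp [Complex.inv_im, neg_div]
  have hN : 0 < Complex.normSq ρ := Complex.normSq_pos.mpr hρ0
  have him' : (ρ * (1 - ρ⁻¹)).im = ρ.im := by
    rw [mul_sub, mul_inv_cancel₀ hρ0]
    simp
  obtain ⟨n, hn⟩ := Real.Angle.angle_eq_iff_two_pi_dvd_sub.mp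
    ((Real.Angle.coe_add _ _).trans (Complex.arg_mul_coe_angle hρ0 h20).symm)
  have a1 := Complex.arg_lt_pi_iff.mpr ((Complex.mem_slitPlane_iff.mp s1).imp le_of_lt id)
  have a2 := Complex.arg_lt_pi_iff.mpr ((Complex.mem_slitPlane_iff.mp s2).imp le_of_lt id)
  have b1 := Complex.neg_pi_lt_arg ρ
  have b2 := Complex.neg_pi_lt_arg (1 - ρ⁻¹)
  rcases lt_trichotomy ρ.im 0 with h | h | h
  · have c1 := Complex.arg_neg_iff.mpr h
    have c2 := Complex.arg_neg_iff.mpr (him ▸ div_neg_of_neg_of_pos h hN)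
    have c3 := Complex.arg_neg_iff.mpr (him' ▸ h)
    have c4 := Complex.neg_pi_lt_arg (ρ * (1 - ρ⁻¹))
    have n1 : (n : ℝ) < 1 := by nlinarith
    have n2 : (-1 : ℝ) < n := by nlinarith
    obtain rfl : n = 0 := by
      have : n < 1 := by exact_mod_cast n1
      have : -1 < n := by exact_mod_cast n2
      omega
    rw [Int.cast_zero, mul_zero] at hn
    rw [abs_lt]
    constructor <;> linarith
  · have r1 : ρ.arg = 0 := Complex.arg_eq_zero_iff.mpr
      ⟨((Complex.mem_slitPlane_iff.mp s1).resolve_right (not_not.mpr h)).le, h⟩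
    have h' : (1 - ρ⁻¹).im = 0 := by rw [him, h, zero_div]
    have r2 : (1 - ρ⁻¹).arg = 0 := Complex.arg_eq_zero_iff.mpr
      ⟨((Complex.mem_slitPlane_iff.mp s2).resolve_right (not_not.mpr h')).le, h'⟩
    rw [r1, r2, add_zero, abs_zero]
    exact hπ
  · have c1 := Complex.arg_nonneg_iff.mpr h.le
    have c2 := Complex.arg_nonneg_iff.mpr (him ▸ (div_pos h hN).le)
    have c3 := Complex.arg_nonneg_iff.mpr (him' ▸ h.le)
    have c4 : (ρ * (1 - ρ⁻¹)).arg < Real.pi :=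
      Complex.arg_lt_pi_iff.mpr (Or.inr (him' ▸ h.ne'))
    have n1 : (n : ℝ) < 1 := by nlinarith
    have n2 : (-1 : ℝ) < n := by nlinarith
    obtain rfl : n = 0 := by
      have : n < 1 := by exact_mod_cast n1
      have : -1 < n := by exact_mod_cast n2
      omega
    rw [Int.cast_zero, mul_zero] at hn
    rw [abs_lt]
    constructor <;> linarith

theorem _root_.abs_orientedAngle_le_pi (A O B : ℂ) : |orientedAngle A O B| ≤ Real.pi :=
  Complex.abs_arg_le_pi _

/-- Every path contains a clean one, as soon as neither half contains the far end of the other. -/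
theorem exists_isClean (c : TwoPath p q) (hp : p ∉ polylineImage c.snd)
    (hq : q ∉ polylineImage c.fst) :
    ∃ c' : TwoPath p q, c'.IsClean ∧ polylineImage c'.fst ⊆ polylineImage c.fst ∧
      polylineImage c'.snd ⊆ polylineImage c.snd := by
  -- The first half is cut at its first point `x` on the second half, and the second half is
  -- restarted at its last visit to `x`.
  obtain ⟨l, u, x, h1, h2, hx, h3, h4⟩ := exists_first_visit
    (isCompact_polylineImage c.snd).isClosed c.fst_head hp ⟨c.mid, c.mid_mem_fst, c.mid_mem_snd⟩
  have hxfst : x ∈ polylineImage c.fst := h4 (last_mem_polylineImage (by simp))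
  obtain ⟨y, r, k1, k2, k3⟩ := exists_last_visit hx c.snd_last
    (fun h => hq (h ▸ hxfst))
  have split : polylineImage (l ++ [u, x]) =
      polylineImage (l ++ [u]) ∪ (segment ℝ u x ∪ {x}) := polylineImage_append_cons l u [x]
  have hux : Disjoint (segment ℝ u x) (polylineImage (y :: r)) := by
    rw [Set.disjoint_left]
    intro w hw hw'
    obtain rfl : w = x := h3 ⟨hw, k3 (Or.inr hw')⟩
    exact k2 hw'
  have hu : u ∉ segment ℝ x y := fun h => Set.disjoint_left.mp h2
    (last_mem_polylineImage (by simp)) (k3 (Or.inl h))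
  have hy : y ∉ segment ℝ u x := fun h =>
    Set.disjoint_left.mp hux h (head_mem_polylineImage y r)
  have hlast : (y :: r).getLast? = some q := by simpa using k1
  let c' : TwoPath p q :=
    { fst := l ++ [u, x]
      snd := x :: y :: r
      mid := x
      fst_head := by
        obtain ⟨s, hs⟩ := exists_eq_cons_of_head? h1
        rw [show l ++ [u, x] = (l ++ [u]) ++ [x] by simp, hs]
        rfl
      fst_last := by simp
      snd_head := rfl
      snd_last := k1 }
  refine ⟨c', ⟨?_, ?_⟩, h4, k3⟩
  · rintro w ⟨hw, hw'⟩
    change w ∈ polylineImage (l ++ [u, x]) at hw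
    rw [split] at hw
    rcases hw with hw | hw | hw
    · exact (Set.disjoint_left.mp h2 hw (k3 hw')).elim
    · exact h3 ⟨hw, k3 hw'⟩
    · exact hw
  -- Only the two segments adjacent to `x` can make the angle jump at `x`; all other terms are
  -- continuous there.
  · have hang : ∀ z, c'.angle z = angleSum z (l ++ [u]) + angleSum z (y :: r) +
        (orientedAngle u z x + orientedAngle x z y) := by
      intro z
      change angleSum z (l ++ u :: [x]) + angleSum z (x :: y :: r) = _
      rw [angleSum_append_cons]
      simp only [angleSum]
      ring
    have hturn : c'.turn = angleSum x (l ++ [u]) + angleSum x (y :: r) +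
        (orientedAngle x u y + orientedAngle u y x) := by
      have d1 := angleSum_sub_angleSum_of_disjoint (M := l ++ [u]) (B := u) (N := x :: y :: r)
        (C := x) h1 (by simp) rfl k1 (h2.mono_right k3)
      have d2 := orientedAngle_sub_eq_angleSum_sub (C := y) rfl hlast hux
      change angleSum q (l ++ u :: [x]) + angleSum p (x :: y :: r) = _
      rw [angleSum_append_cons]
      simp only [angleSum] at d1 d2 ⊢
      linarith
    have hlt := abs_orientedAngle_add_orientedAngle_lt hu hy
    set κ := orientedAngle x u y + orientedAngle u y x with hκ
    -- The two angles at the segments adjacent to `x` contribute at most `2π`, and `turn` adds `|κ|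
    -- < π`. Half of the remaining gap `π - |κ|` allows for continuity and half is left as `ε`.
    refine ⟨(Real.pi - |κ|) / 2, by linarith, ?_⟩
    have hcont : ContinuousAt (fun z => angleSum z (l ++ [u]) + angleSum z (y :: r)) x :=
      (continuousAt_angleSum fun h => Set.disjoint_left.mp h2 h hx).add
        (continuousAt_angleSum k2)
    filter_upwards [Metric.tendsto_nhds.mp hcont ((Real.pi - |κ|) / 2) (by linarith)] with z hz
    rw [hang, hturn]
    rw [Real.dist_eq] at hz
    have t1 := abs_le.mp (abs_orientedAngle_le_pi u z x)
    have t2 := abs_le.mp (abs_orientedAngle_le_pi x z y)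
    have t3 := le_abs_self κ
    have t4 := neg_abs_le κ
    rw [abs_lt] at hz ⊢
    constructor <;> linarith [hz.1, hz.2, t1.1, t1.2, t2.1, t2.2]

/-! ### Three paths and a cycle -/

theorem CrossDisjoint.mono {c' d' : TwoPath p q} (h : c.CrossDisjoint d)
    (hc1 : polylineImage c'.fst ⊆ polylineImage c.fst)
    (hc2 : polylineImage c'.snd ⊆ polylineImage c.snd)
    (hd1 : polylineImage d'.fst ⊆ polylineImage d.fst)
    (hd2 : polylineImage d'.snd ⊆ polylineImage d.snd) : c'.CrossDisjoint d' :=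
  ⟨h.1.mono hc1 hd2, h.2.mono hc2 hd1⟩

/-- A closed polygonal line through the marked points of three pairwise cross-disjoint paths from
`p` to `q`, each of its three parts being disjoint from the path that does not meet its ends, has
winding numbers around `p` and `q` that differ by `±1`. -/
theorem angleSum_sub_angleSum_eq_two_pi_or {c₀ c₁ c₂ : TwoPath p q} (h₀₁ : c₀.CrossDisjoint c₁)
    (h₁₂ : c₁.CrossDisjoint c₂) (h₂₀ : c₂.CrossDisjoint c₀) {E₀ E₁ E₂ : List ℂ}
    (E₀_head : E₀.head? = some c₁.mid) (E₀_last : E₀.getLast? = some c₂.mid)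
    (E₁_head : E₁.head? = some c₂.mid) (E₁_last : E₁.getLast? = some c₀.mid)
    (E₂_head : E₂.head? = some c₀.mid) (E₂_last : E₂.getLast? = some c₁.mid)
    (f₀ : Disjoint (polylineImage E₀) (polylineImage c₀.fst))
    (g₀ : Disjoint (polylineImage E₀) (polylineImage c₀.snd))
    (f₁ : Disjoint (polylineImage E₁) (polylineImage c₁.fst))
    (g₁ : Disjoint (polylineImage E₁) (polylineImage c₁.snd))
    (f₂ : Disjoint (polylineImage E₂) (polylineImage c₂.fst))
    (g₂ : Disjoint (polylineImage E₂) (polylineImage c₂.snd)) {W : ℝ}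
    (hW : W = (angleSum q E₀ + angleSum q E₁ + angleSum q E₂) -
      (angleSum p E₀ + angleSum p E₁ + angleSum p E₂)) :
    W = 2 * Real.pi ∨ W = -(2 * Real.pi) := by
  have hπ := Real.pi_pos
  -- the oddness
  obtain ⟨t, rfl, ht⟩ : ∃ t : ℝ, W = 2 * t ∧ (t : Real.Angle) = Real.pi := by
    refine ⟨-((c₀.angle c₁.mid - c₁.turn) + (c₁.angle c₂.mid - c₂.turn) +
      (c₂.angle c₀.mid - c₀.turn)), ?_, ?_⟩
    · have e₀ := angleSum_sub_eq_angle_sub E₀_head E₀_last f₀ g₀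
      have e₁ := angleSum_sub_eq_angle_sub E₁_head E₁_last f₁ g₁
      have e₂ := angleSum_sub_eq_angle_sub E₂_head E₂_last f₂ g₂
      have b₀₁ := angle_mid_add_angle_mid h₀₁
      have b₁₂ := angle_mid_add_angle_mid h₁₂
      have b₂₀ := angle_mid_add_angle_mid h₂₀
      linarith
    · rw [Real.Angle.coe_neg, Real.Angle.coe_add, Real.Angle.coe_add, coe_angle_mid_sub_turn h₀₁,
        coe_angle_mid_sub_turn h₁₂, coe_angle_mid_sub_turn h₂₀, Real.Angle.coe_pi_add_coe_pi,
        zero_add, Real.Angle.neg_coe_pi]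
  -- the bound
  obtain ⟨d₀, cl₀, s₀, t₀⟩ := c₀.exists_isClean h₀₁.left_notMem h₀₁.right_notMem
  obtain ⟨d₁, cl₁, s₁, t₁⟩ := c₁.exists_isClean h₁₂.left_notMem h₁₂.right_notMem
  obtain ⟨d₂, cl₂, s₂, t₂⟩ := c₂.exists_isClean h₂₀.left_notMem h₂₀.right_notMem
  have k₀₁ : d₀.CrossDisjoint d₁ := h₀₁.mono s₀ t₀ s₁ t₁
  have k₁₂ : d₁.CrossDisjoint d₂ := h₁₂.mono s₁ t₁ s₂ t₂
  have k₂₀ : d₂.CrossDisjoint d₀ := h₂₀.mono s₂ t₂ s₀ t₀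
  have e₀ := angleSum_sub_eq_angle_sub (c := d₀) E₀_head E₀_last (f₀.mono_right s₀)
    (g₀.mono_right t₀)
  have e₁ := angleSum_sub_eq_angle_sub (c := d₁) E₁_head E₁_last (f₁.mono_right s₁)
    (g₁.mono_right t₁)
  have e₂ := angleSum_sub_eq_angle_sub (c := d₂) E₂_head E₂_last (f₂.mono_right s₂)
    (g₂.mono_right t₂)
  -- The cycle still runs through the original marked points, so these serve as third points. The
  -- three quantities estimated here sum to `W - X`, where `X` is the sum of `dᵢ.angle dⱼ.mid -
  -- dⱼ.turn` over the pairs 01, 12, 20.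
  have a₂ := abs_le.mp (abs_angle_sub_angle_sub_le (e := c₂) k₀₁
    (h₂₀.symm.mono s₀ t₀ subset_rfl subset_rfl) (h₁₂.mono s₁ t₁ subset_rfl subset_rfl) cl₀ cl₁)
  have a₀ := abs_le.mp (abs_angle_sub_angle_sub_le (e := c₀) k₁₂
    (h₀₁.symm.mono s₁ t₁ subset_rfl subset_rfl) (h₂₀.mono s₂ t₂ subset_rfl subset_rfl) cl₁ cl₂)
  have a₁ := abs_le.mp (abs_angle_sub_angle_sub_le (e := c₁) k₂₀
    (h₁₂.symm.mono s₂ t₂ subset_rfl subset_rfl) (h₀₁.mono s₀ t₀ subset_rfl subset_rfl) cl₂ cl₀)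
  -- By the balance relations the quantity estimated here is `-X`, so `|X| ≤ π` and `|W| ≤ 4π`.
  have a := abs_le.mp (abs_angle_sub_angle_sub_le (e := d₂) k₀₁ k₂₀.symm k₁₂ cl₀ cl₁)
  have b₀₁ := angle_mid_add_angle_mid k₀₁
  have b₁₂ := angle_mid_add_angle_mid k₁₂
  have b₂₀ := angle_mid_add_angle_mid k₂₀
  have hlt : |t| < 3 * Real.pi := by
    rw [abs_lt]
    constructor <;> linarith [a.1, a.2, a₀.1, a₀.2, a₁.1, a₁.2, a₂.1, a₂.2]
  rcases eq_pi_or_eq_neg_pi_of_coe_eq_pi ht hlt with rfl | rfl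
  · exact Or.inl rfl
  · exact Or.inr (by ring)

end TwoPath

/-! ### Closed polygonal lines and the winding numbers of the cycle. -/

theorem exists_int_polygonWinding (l : List ℂ) (z : ℂ)
    (h : z ∉ polylineImage (l ++ l.take 1)) : ∃ m : ℤ, polygonWinding l z = m := by
  cases l with
  | nil => exact ⟨0, by simp [polygonWinding, angleSum]⟩
  | cons A l =>
    have hcoe := coe_angleSum (l := (A :: l) ++ [A]) (A := A) (B := A) rfl
      List.getLast?_concat h
    rw [sub_self, Real.Angle.coe_eq_zero_iff] at hcoe
    obtain ⟨m, hm⟩ := hcoe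
    refine ⟨m, ?_⟩
    have := Real.pi_pos
    rw [polygonWinding, List.take_succ_cons, List.take_zero, ← hm, zsmul_eq_mul]
    field_simp

/-- The closed polygonal line composed of three polygonal lines. -/
theorem dropLast_append_closed {E₀ E₁ E₂ : List ℂ} {A B C : ℂ} (hAB : A ≠ B)
    (h₀ : E₀.head? = some A) (h₀' : E₀.getLast? = some B) (h₁ : E₁.head? = some B)
    (h₁' : E₁.getLast? = some C) (h₂ : E₂.head? = some C) (h₂' : E₂.getLast? = some A) :
    let L := E₀.dropLast ++ (E₁.dropLast ++ (E₂.dropLast ++ []))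
    polylineImage (L ++ L.take 1) = polylineImage E₀ ∪ (polylineImage E₁ ∪ polylineImage E₂) ∧
      ∀ z, angleSum z (L ++ L.take 1) = angleSum z E₀ + (angleSum z E₁ + angleSum z E₂) := by
  obtain ⟨F₀, rfl⟩ := List.getLast?_eq_some_iff.mp h₀'
  obtain ⟨F₁, rfl⟩ := List.getLast?_eq_some_iff.mp h₁'
  obtain ⟨F₂, rfl⟩ := List.getLast?_eq_some_iff.mp h₂'
  -- Since `A ≠ B`, the first line keeps its initial point `A` after `dropLast`, so `L.take 1` is
  -- `[A]` and closes the polygon.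
  obtain ⟨G₀, rfl⟩ : ∃ G₀, F₀ = A :: G₀ := by
    cases F₀ with
    | nil => exact (hAB (by simpa using h₀.symm)).elim
    | cons X G => exact ⟨G, by simpa using h₀⟩
  obtain ⟨G₁, hG₁⟩ := exists_eq_cons_of_head? h₁
  obtain ⟨G₂, hG₂⟩ := exists_eq_cons_of_head? h₂
  intro L
  have hL : L ++ L.take 1 = (A :: G₀) ++ (F₁ ++ (F₂ ++ [A])) := by
    simp only [L, List.dropLast_concat, List.append_nil]
    simp
  have e₁ : F₁ ++ C :: G₂ = B :: (G₁ ++ G₂) := by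
    rw [← List.cons_append, ← hG₁]; simp
  rw [hL, hG₂, e₁]
  constructor
  · rw [polylineImage_append_cons (A :: G₀), ← e₁, polylineImage_append_cons F₁]
  · intro z
    rw [angleSum_append_cons z (A :: G₀), ← e₁, angleSum_append_cons z F₁]

/-- For every almost embedding `f : K₅ - 45 → ℝ²`, the winding numbers `w_f(123, 4)` and
`w_f(123, 5)` are integers whose difference is odd, and equal to `±1`. -/
theorem mainTheorem2 (f : PLMap K5minus45) (hf : f.IsAlmostEmbedding) :
    ∃ m n : ℤ, f.winding cycle123 3 = (m : ℝ) ∧ f.winding cycle123 4 = (n : ℝ) ∧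
      m - n ≡ 1 [ZMOD 2] ∧ (m - n = 1 ∨ m - n = -1) := by
  have h01 : K5minus45.Adj 0 1 := by simp [K5minus45]
  have h12 : K5minus45.Adj 1 2 := by simp [K5minus45]
  have h20 : K5minus45.Adj 2 0 := by simp [K5minus45]
  have a0 : K5minus45.Adj 3 0 := by simp [K5minus45]
  have a1 : K5minus45.Adj 3 1 := by simp [K5minus45]
  have a2 : K5minus45.Adj 3 2 := by simp [K5minus45]
  have b0 : K5minus45.Adj 0 4 := by simp [K5minus45]
  have b1 : K5minus45.Adj 1 4 := by simp [K5minus45]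
  have b2 : K5minus45.Adj 2 4 := by simp [K5minus45]
  have hdisj : ∀ {a b c d : Fin 5} (h : K5minus45.Adj a b) (h' : K5minus45.Adj c d),
      a ≠ c ∧ a ≠ d ∧ b ≠ c ∧ b ≠ d →
        Disjoint (polylineImage (f.edge h)) (polylineImage (f.edge h')) :=
    fun h h' hne => Set.disjoint_iff_inter_eq_empty.mpr
      (hf.edge_edge h h' hne.1 hne.2.1 hne.2.2.1 hne.2.2.2)
  let c : ∀ (i : Fin 5), K5minus45.Adj 3 i → K5minus45.Adj i 4 →
      TwoPath (f.vertex 3) (f.vertex 4) := fun i h h' =>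
    { fst := f.edge h
      snd := f.edge h'
      mid := f.vertex i
      fst_head := f.edge_head h
      fst_last := f.edge_last h
      snd_head := f.edge_head h'
      snd_last := f.edge_last h' }
  obtain ⟨himage, hsum⟩ := dropLast_append_closed (hf.vertex_vertex (u := 0) (v := 1) (by decide))
    (f.edge_head h01) (f.edge_last h01) (f.edge_head h12) (f.edge_last h12) (f.edge_head h20)
    (f.edge_last h20)
  have hoff : ∀ v : Fin 5, v ≠ 0 → v ≠ 1 → v ≠ 2 → f.vertex v ∉
      polylineImage (f.restrict cycle123 ++ (f.restrict cycle123).take 1) := by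
    intro v hv0 hv1 hv2
    refine fun h => ?_
    rcases himage.subset h with h | h | h
    · exact hf.vertex_edge v h01 hv0 hv1 h
    · exact hf.vertex_edge v h12 hv1 hv2 h
    · exact hf.vertex_edge v h20 hv2 hv0 h
  obtain ⟨m, hm⟩ := exists_int_polygonWinding _ _ (hoff 3 (by decide) (by decide) (by decide))
  obtain ⟨n, hn⟩ := exists_int_polygonWinding _ _ (hoff 4 (by decide) (by decide) (by decide))
  -- `Eᵢ` is the edge of the triangle opposite to `i`; every disjointness needed is that of two
  -- non-adjacent edges.
  have key := TwoPath.angleSum_sub_angleSum_eq_two_pi_or (c₀ := c 0 a0 b0) (c₁ := c 1 a1 b1)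
    (c₂ := c 2 a2 b2) ⟨hdisj a0 b1 (by decide), hdisj b0 a1 (by decide)⟩
    ⟨hdisj a1 b2 (by decide), hdisj b1 a2 (by decide)⟩
    ⟨hdisj a2 b0 (by decide), hdisj b2 a0 (by decide)⟩
    (f.edge_head h12) (f.edge_last h12) (f.edge_head h20) (f.edge_last h20)
    (f.edge_head h01) (f.edge_last h01)
    (hdisj h12 a0 (by decide)) (hdisj h12 b0 (by decide))
    (hdisj h20 a1 (by decide)) (hdisj h20 b1 (by decide))
    (hdisj h01 a2 (by decide)) (hdisj h01 b2 (by decide)) rfl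
  have hw : ∀ v, f.winding cycle123 v * (2 * Real.pi) = angleSum (f.vertex v) (f.edge h01) +
      (angleSum (f.vertex v) (f.edge h12) + angleSum (f.vertex v) (f.edge h20)) := by
    intro v
    rw [PLMap.winding, polygonWinding, div_mul_cancel₀ _ Real.two_pi_pos.ne']
    exact hsum (f.vertex v)
  have h3 := hw 3
  have h4 := hw 4
  rw [show f.winding cycle123 3 = m from hm] at h3
  rw [show f.winding cycle123 4 = n from hn] at h4
  have hmn : m - n = 1 ∨ m - n = -1 := by
    -- `key` takes the angle around the image of 5 minus that around the image of 4, so the signs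
    -- are reversed.
    rcases key with h | h
    · right
      have : ((m - n : ℤ) : ℝ) * (2 * Real.pi) = ((-1 : ℤ) : ℝ) * (2 * Real.pi) := by
        push_cast
        linarith
      exact_mod_cast mul_right_cancel₀ Real.two_pi_pos.ne' this
    · left
      have : ((m - n : ℤ) : ℝ) * (2 * Real.pi) = ((1 : ℤ) : ℝ) * (2 * Real.pi) := by
        push_cast
        linarith
      exact_mod_cast mul_right_cancel₀ Real.two_pi_pos.ne' this
  refine ⟨m, n, hm, hn, ?_, hmn⟩
  rcases hmn with h | h <;> rw [h]
  decide
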